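/- Let $K$ be a field of characteristic zero (for example $\mathbb{R}$ or $\mathbb{C}$), let $n,d\ge 0$ be integers, let $R=K[x_1,\dots,x_n]$, and let $R_{=k}$ denote the $K$-vector space of homogeneous polynomials of degree $k$ in $R$ (including $0$). For homogeneous polynomials $h_1,\dots,h_t\in R_{=d}$ write $\langle h_1,\dots,h_t\rangle_{2d+1}=\langle h_1,\dots,h_t\rangle\cap R_{=2d+1}$ for the degree-$(2d+1)$ part of the ideal they generate, and call this part *maximal* if its dimension is the largest one attained by any $t$ elements of $R_{=d}$. 1. Let $t=n$, and suppose that one of the following holds: $n=2$ ($d$ arbitrary); $n=3$ and $d\le 3$; $n=4$ and $d\le 2$; $n\ge 5$ and $d=1$. Then for all $h_1,\dots,h_n\in R_{=d}$ such that $\langle h_1,\dots,h_n\rangle_{2d+1}$ is maximal, $\langle h_1,\dots,h_n\rangle_{2d+1}=R_{=2d+1}$. Moreover, $\langle x_1^d,\dots,x_n^d\rangle_{2d+1}=R_{=2d+1}$. 2. Let $t=n+1$, and suppose that one of the following holds: $n\in\{2,3\}$ ($d$ arbitrary); $n=4$ and $d\le 6$; $n=5$ and $d\le 3$; $n\in\{6,7,8\}$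 and $d\le 2$; $n\ge 9$ and $d=1$. Then for all $h_1,\dots,h_{n+1}\in R_{=d}$ such that $\langle h_1,\dots,h_{n+1}\rangle_{2d+1}$ is maximal, $\langle h_1,\dots,h_{n+1}\rangle_{2d+1}=R_{=2d+1}$. Moreover, $\langle x_1^d,\dots,x_n^d,(x_1+\dots+x_n)^d\rangle_{2d+1}=R_{=2d+1}$. -/

import Mathlib

/-- The homogeneous part of degree `k` of the ideal generated by the polynomials `h i`:
the `K`-vector space of all forms of degree `k` lying in the ideal. -/
noncomputable def idealPart {K : Type*} [Field K] {n t : ℕ}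
    (h : Fin t → MvPolynomial (Fin n) K) (k : ℕ) : Submodule K (MvPolynomial (Fin n) K) :=
  (Ideal.span (Set.range h)).restrictScalars K ⊓ MvPolynomial.homogeneousSubmodule (Fin n) K k

/-- `h` is a system of `t` forms of degree `d` in `n` variables for which the (finite) dimension of
the degree `k` part of the generated ideal is the largest possible among all systems of `t` forms
of degree `d` in `n` variables. -/
def HasMaximalPart {K : Type*} [Field K] {n t : ℕ} (d k : ℕ)
    (h : Fin t → MvPolynomial (Fin n) K) : Prop :=
  (∀ i, (h i).IsHomogeneous d) ∧
    ∀ g : Fin t → MvPolynomial (Fin n) K, (∀ i, (g i).IsHomogeneous d) →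
      Module.finrank K (idealPart g k) ≤ Module.finrank K (idealPart h k)

/-- The pairs `(n, d)` of the case of `n` forms of degree `d` in `n` variables. -/
def SquareCase (n d : ℕ) : Prop :=
  n = 2 ∨ (n = 3 ∧ d ≤ 3) ∨ (n = 4 ∧ d ≤ 2) ∨ (5 ≤ n ∧ d = 1)

/-- The pairs `(n, d)` of the case of `n + 1` forms of degree `d` in `n` variables. -/
def OverdeterminedCase (n d : ℕ) : Prop :=
  n = 2 ∨ n = 3 ∨ (n = 4 ∧ d ≤ 6) ∨ (n = 5 ∧ d ≤ 3) ∨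
    ((n = 6 ∨ n = 7 ∨ n = 8) ∧ d ≤ 2) ∨ (9 ≤ n ∧ d = 1)

/-- The system `x₁ ^ d, …, xₙ ^ d`. -/
noncomputable def powerSystem (K : Type*) [Field K] (n d : ℕ) :
    Fin n → MvPolynomial (Fin n) K :=
  fun i => MvPolynomial.X i ^ d

/-- The system `x₁ ^ d, …, xₙ ^ d, (x₁ + ⋯ + xₙ) ^ d`. -/
noncomputable def powerSumSystem (K : Type*) [Field K] (n d : ℕ) :
    Fin (n + 1) → MvPolynomial (Fin n) K :=
  Fin.snoc (powerSystem K n d) ((∑ i, MvPolynomial.X i) ^ d)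

open MvPolynomial

/-! By maximality it suffices that one explicit system fills degree `2d + 1`. For the pure powers
this is the pigeonhole principle, as `n(d - 1) < 2d + 1` in the listed cases. With the extra form `ℓ
^ d`, `ℓ = ∑ X i`, it says that multiplication by `ℓ ^ d` from degree `d + 1` to `2d + 1` is onto in
`K[X] / (X i ^ d)`, which is strong Lefschetz (`exists_sum_X_pow_mul_sub_mem`) for `n(d - 1) ≤ 3d +
2`. It is proved by `sl₂` theory: `ℓ` raises, `lowering` lowers. -/

/-- The ideal generated by the `d`-th powers of the variables. -/
noncomputable def powerIdeal (σ R : Type*) [CommRing R] (d : ℕ) : Ideal (MvPolynomial σ R) :=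
  Ideal.span (Set.range fun i => X i ^ d)

/-- The `i`-th summand of `lowering`, acting on powers of `X i` by
`X i ^ a ↦ a (e + 1 - a) X i ^ (a - 1)`. -/
noncomputable def loweringAt {σ R : Type*} [CommRing R] (e : ℕ) (i : σ) :
    MvPolynomial σ R →ₗ[R] MvPolynomial σ R :=
  (e : R) • (pderiv i).toLinearMap -
    LinearMap.mulLeft R (X i) ∘ₗ (pderiv i).toLinearMap ∘ₗ (pderiv i).toLinearMap

/-- The lowering operator of the `sl₂`-action on `R[X]` for which multiplication by the sum of the
variables is the raising operator and which descends to the quotient by the ideal generated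
by the `X i ^ (e + 1)`. -/
noncomputable def lowering (σ R : Type*) [Fintype σ] [CommRing R] (e : ℕ) :
    MvPolynomial σ R →ₗ[R] MvPolynomial σ R :=
  ∑ i, loweringAt e i

/-! ### The `sl₂`-action modulo powers of the variables. -/

section Lowering

variable {σ R : Type*} [CommRing R]

theorem loweringAt_apply (e : ℕ) (i : σ) (p : MvPolynomial σ R) :
    loweringAt e i p = (e : MvPolynomial σ R) * pderiv i p - X i * pderiv i (pderiv i p) := by
  simp [loweringAt, MvPolynomial.smul_eq_C_mul]

/-- The factor `a (e + 1 - a)` vanishes at `a = e + 1`, so the only term with too low a power of `X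
j` cancels. -/
theorem loweringAt_mul_X_pow_mem (e : ℕ) (i j : σ) (p : MvPolynomial σ R) :
    loweringAt e i (p * X j ^ (e + 1)) ∈ powerIdeal σ R (e + 1) := by
  have hX : (X j ^ (e + 1) : MvPolynomial σ R) ∈ powerIdeal σ R (e + 1) :=
    Ideal.subset_span ⟨j, rfl⟩
  suffices ∃ q, loweringAt e i (p * X j ^ (e + 1)) = q * X j ^ (e + 1) by
    obtain ⟨q, hq⟩ := this
    exact hq ▸ Ideal.mul_mem_left _ q hX
  simp only [loweringAt_apply]
  rcases eq_or_ne j i with rfl | hij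
  · refine ⟨(e : MvPolynomial σ R) * pderiv j p - 2 * ((e : MvPolynomial σ R) + 1) * pderiv j p -
      X j * pderiv j (pderiv j p), ?_⟩
    -- The factor `e` repairs the truncated exponent `e - 1` at `e = 0`.
    have h : (e : MvPolynomial σ R) * X j ^ (e - 1) * X j =
        (e : MvPolynomial σ R) * X j ^ e := by
      cases e <;> simp [pow_succ, mul_assoc]
    simp only [pderiv_mul, pderiv_pow, pderiv_X_self, map_add, Derivation.map_natCast,
      Nat.add_sub_cancel, Nat.cast_add, Nat.cast_one, pderiv_one]
    linear_combination (-((e : MvPolynomial σ R) + 1) * p) * h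
  · refine ⟨(e : MvPolynomial σ R) * pderiv i p - X i * pderiv i (pderiv i p), ?_⟩
    simp only [pderiv_mul, pderiv_pow, pderiv_X_of_ne hij, mul_zero, add_zero]
    ring

theorem loweringAt_mul (e : ℕ) (i : σ) (l p : MvPolynomial σ R) (hl : pderiv i l = 1) :
    loweringAt e i (l * p) = l * loweringAt e i p + (e : MvPolynomial σ R) * p -
      2 * (X i * pderiv i p) := by
  simp only [loweringAt_apply, pderiv_mul, hl, map_add, pderiv_one]
  ring

theorem isHomogeneous_loweringAt (e : ℕ) (i : σ) {p : MvPolynomial σ R} {m : ℕ}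
    (hp : p.IsHomogeneous (m + 1)) : (loweringAt e i p).IsHomogeneous m := by
  rw [loweringAt_apply]
  have h1 : (pderiv i p).IsHomogeneous m := hp.pderiv
  refine IsHomogeneous.sub ?_ ?_
  · simpa using h1.C_mul (e : R)
  · cases m with
    | zero =>
      rw [← totalDegree_zero_iff_isHomogeneous, totalDegree_eq_zero_iff_eq_C] at h1
      rw [h1, pderiv_C, mul_zero]
      exact isHomogeneous_zero _ _ _
    | succ m => simpa [add_comm] using (isHomogeneous_X R i).mul h1.pderiv

variable [Fintype σ]

theorem lowering_mem_powerIdeal (e : ℕ) {p : MvPolynomial σ R}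
    (hp : p ∈ powerIdeal σ R (e + 1)) : lowering σ R e p ∈ powerIdeal σ R (e + 1) := by
  rw [lowering, LinearMap.sum_apply]
  refine Ideal.sum_mem _ fun i _ => ?_
  obtain ⟨c, rfl⟩ := Finsupp.mem_ideal_span_range_iff_exists_finsupp.1 hp
  rw [Finsupp.sum, map_sum]
  exact Ideal.sum_mem _ fun j _ => loweringAt_mul_X_pow_mem e i j _

theorem isHomogeneous_lowering (e : ℕ) {p : MvPolynomial σ R} {m : ℕ}
    (hp : p.IsHomogeneous (m + 1)) : (lowering σ R e p).IsHomogeneous m := by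
  rw [lowering, LinearMap.sum_apply]
  exact IsHomogeneous.sum _ _ _ fun i _ => isHomogeneous_loweringAt e i hp

theorem isHomogeneous_lowering_iterate (e : ℕ) {p : MvPolynomial σ R} {m : ℕ} (k : ℕ)
    (hp : p.IsHomogeneous (m + k)) : ((lowering σ R e)^[k] p).IsHomogeneous m := by
  induction k generalizing m with
  | zero => exact hp
  | succ k ih =>
    rw [Function.iterate_succ_apply']
    exact isHomogeneous_lowering e (ih (by rwa [add_assoc, add_comm 1]))

/-- The commutation relation between raising and lowering operators. -/
theorem lowering_sum_X_mul (e : ℕ) {p : MvPolynomial σ R} {m : ℕ} (hp : p.IsHomogeneous m) :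
    lowering σ R e ((∑ i, X i) * p) = (∑ i, X i) * lowering σ R e p +
      ((Fintype.card σ * e : ℕ) - 2 * m : MvPolynomial σ R) * p := by
  classical
  have hl (i : σ) : pderiv i (∑ j, X j : MvPolynomial σ R) = 1 := by
    simp [pderiv_X, Pi.single_apply]
  simp only [lowering, LinearMap.sum_apply, loweringAt_mul e _ _ p (hl _)]
  rw [Finset.sum_sub_distrib, Finset.sum_add_distrib, ← Finset.mul_sum, ← Finset.mul_sum,
    ← Finset.mul_sum,
    hp.sum_X_mul_pderiv]
  simp
  ring

/-- Pigeonhole: each monomial has some exponent above `e`. -/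
theorem mem_powerIdeal_of_isHomogeneous (e : ℕ) {p : MvPolynomial σ R} {m : ℕ}
    (hp : p.IsHomogeneous m) (hm : Fintype.card σ * e < m) : p ∈ powerIdeal σ R (e + 1) := by
  rw [p.as_sum]
  refine Ideal.sum_mem _ fun a ha => ?_
  have hdeg : m = a.degree := hp.degree_eq_sum_deg_support ha
  obtain ⟨i, hi⟩ : ∃ i, e < a i := by
    by_contra! h
    have := Finset.sum_le_card_nsmul Finset.univ a e fun i _ => h i
    rw [← Finsupp.degree_eq_sum] at this
    simp only [Finset.card_univ, smul_eq_mul] at this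
    omega
  have hdvd : (X i ^ (e + 1) : MvPolynomial σ R) ∣ monomial a (coeff a p) := by
    rw [X_pow_eq_monomial, monomial_dvd_monomial]
    exact ⟨Or.inr (Finsupp.single_le_iff.2 hi), one_dvd _⟩
  exact Ideal.mem_of_dvd _ hdvd (Ideal.subset_span ⟨i, rfl⟩)

/-- Raising the `s`-th lowering of a highest weight vector. -/
theorem sum_X_mul_lowering_iterate_sub_mem (e : ℕ) {u : MvPolynomial σ R} {j w : ℕ}
    (hu : u.IsHomogeneous j) (hw : Fintype.card σ * e + w = 2 * j)
    (hE : (∑ i, X i) * u ∈ powerIdeal σ R (e + 1)) (s : ℕ) (hs : s + 1 ≤ j) :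
    (∑ i, X i) * (lowering σ R e)^[s + 1] u -
      ((s + 1) * (w - s) : MvPolynomial σ R) * (lowering σ R e)^[s] u ∈
        powerIdeal σ R (e + 1) := by
  have hw' : ((Fintype.card σ * e : ℕ) : MvPolynomial σ R) + w = 2 * j := by
    exact_mod_cast congrArg (Nat.cast (R := MvPolynomial σ R)) hw
  induction s with
  | zero =>
    have h := lowering_mem_powerIdeal e hE
    rw [lowering_sum_X_mul e hu] at h
    convert h using 1
    simp only [zero_add, Function.iterate_one, Function.iterate_zero, id, Nat.cast_zero]
    linear_combination -u * hw'
  | succ s ih =>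
    -- Lower the relation for `s` and commute; the coefficients add up by `(s + 1)(w - s) + w - 2(s
    -- + 1) = (s + 2)(w - s - 1)`.
    have h := lowering_mem_powerIdeal e (ih (by omega))
    obtain ⟨r, rfl⟩ : ∃ r, j = r + (s + 1) := ⟨j - (s + 1), by omega⟩
    have hc : ((s + 1) * (w - s) : MvPolynomial σ R) = C ((s + 1) * (w - s) : R) := by simp
    rw [map_sub, lowering_sum_X_mul e (isHomogeneous_lowering_iterate e (s + 1) hu), hc, C_mul',
      map_smul, ← C_mul', ← hc, ← Function.iterate_succ_apply' (lowering σ R e),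
      ← Function.iterate_succ_apply' (lowering σ R e)] at h
    convert h using 1
    push_cast at hw' ⊢
    linear_combination -((lowering σ R e)^[s + 1] u) * hw'

end Lowering

/-! ### Strong Lefschetz surjectivity. -/

section Lefschetz

variable {σ K : Type*} [Fintype σ] [Field K] [CharZero K]

/-- Lowering a highest weight vector and raising it again recovers it up to a unit. -/
theorem exists_sum_X_pow_mul_sub_mem_of_highestWeight (e : ℕ) {u : MvPolynomial σ K} {i k : ℕ}
    (hu : u.IsHomogeneous (i + k)) (hk : Fintype.card σ * e ≤ 2 * i + k)
    (hE : (∑ i, X i) * u ∈ powerIdeal σ K (e + 1)) :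
    ∃ z : MvPolynomial σ K, z.IsHomogeneous i ∧
      (∑ i, X i) ^ k * z - u ∈ powerIdeal σ K (e + 1) := by
  obtain ⟨w, hw⟩ : ∃ w, Fintype.card σ * e + w = 2 * (i + k) :=
    ⟨2 * (i + k) - Fintype.card σ * e, by omega⟩
  have key (s : ℕ) (hs : s ≤ k) : ∃ c : K, c ≠ 0 ∧
      (∑ i, X i) ^ s * (lowering σ K e)^[s] u - C c * u ∈ powerIdeal σ K (e + 1) := by
    induction s with
    | zero => exact ⟨1, one_ne_zero, by simp⟩
    | succ s ih =>
      obtain ⟨c, hc, hmem⟩ := ih (by omega)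
      -- `hk` gives `w ≥ k > s`, and the characteristic is zero.
      have hne : ((s + 1) * (w - s) : K) ≠ 0 := by
        refine mul_ne_zero (by exact_mod_cast s.succ_ne_zero) (sub_ne_zero.2 ?_)
        exact_mod_cast (by omega : w ≠ s)
      refine ⟨(s + 1) * (w - s) * c, mul_ne_zero hne hc, ?_⟩
      have h := sum_X_mul_lowering_iterate_sub_mem e hu hw hE s (by omega)
      convert Ideal.add_mem _ (Ideal.mul_mem_left _ ((∑ i, X i) ^ s) h)
        (Ideal.mul_mem_left _ (C ((s + 1) * (w - s) : K)) hmem) using 1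
      simp only [map_mul, map_add, map_sub, map_natCast, map_one]
      ring
  obtain ⟨c, hc, hmem⟩ := key k le_rfl
  refine ⟨C c⁻¹ * (lowering σ K e)^[k] u, (isHomogeneous_lowering_iterate e k hu).C_mul _, ?_⟩
  convert Ideal.mul_mem_left _ (C c⁻¹) hmem using 1
  have : (C c⁻¹ * C c : MvPolynomial σ K) = 1 := by rw [← map_mul, inv_mul_cancel₀ hc, map_one]
  linear_combination u * this

/-- The surjectivity part of the strong Lefschetz property of the monomial complete intersection
`K[X] / (X i ^ (e + 1))` in characteristic zero. -/
theorem exists_sum_X_pow_mul_sub_mem (e : ℕ) {u : MvPolynomial σ K} {i k : ℕ}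
    (hu : u.IsHomogeneous (i + k)) (hk : Fintype.card σ * e ≤ 2 * i + k) :
    ∃ z : MvPolynomial σ K, z.IsHomogeneous i ∧
      (∑ i, X i) ^ k * z - u ∈ powerIdeal σ K (e + 1) := by
  have hl : (∑ i, X i : MvPolynomial σ K).IsHomogeneous 1 :=
    IsHomogeneous.sum _ _ _ fun i _ => isHomogeneous_X K i
  -- Passing from `(i + 1, k)` to `(i, k + 2)` keeps `2 * i + k`. If `ℓu ≡ ℓ ^ (k + 2) z`, then `u -
  -- ℓ ^ (k + 1) z` is killed by `ℓ`, hence is a highest weight vector.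
  induction i generalizing k u with
  | zero =>
    exact exists_sum_X_pow_mul_sub_mem_of_highestWeight e hu hk
      (mem_powerIdeal_of_isHomogeneous e (hl.mul hu) (by omega))
  | succ i ih =>
    have hEu : ((∑ i, X i) * u).IsHomogeneous (i + (k + 2)) := by
      convert hl.mul hu using 1
      omega
    obtain ⟨z, hz, hmem⟩ := ih hEu (by omega)
    have hv : (u - (∑ i, X i) ^ (k + 1) * z).IsHomogeneous (i + 1 + k) := by
      refine hu.sub ?_
      rw [show i + 1 + k = 1 * (k + 1) + i by ring]
      exact (hl.pow (k + 1)).mul hz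
    obtain ⟨y, hy, hmem'⟩ := exists_sum_X_pow_mul_sub_mem_of_highestWeight e hv hk (by
      convert Submodule.neg_mem _ hmem using 1
      ring)
    refine ⟨(∑ i, X i) * z + y, ?_, ?_⟩
    · refine IsHomogeneous.add ?_ hy
      convert hl.mul hz using 1
      omega
    · convert hmem' using 1
      ring

end Lefschetz

/-! ### Transfer to ideal parts and numerical cases. -/

section IdealPart

variable {K : Type*} [Field K] {n t : ℕ}

theorem idealPart_eq_of_forall_mem {h : Fin t → MvPolynomial (Fin n) K} {k : ℕ}
    (H : ∀ p : MvPolynomial (Fin n) K, p.IsHomogeneous k → p ∈ Ideal.span (Set.range h)) :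
    idealPart h k = homogeneousSubmodule (Fin n) K k :=
  inf_eq_right.2 fun p hp => H p hp

theorem HasMaximalPart.idealPart_eq {d k : ℕ} {g h : Fin t → MvPolynomial (Fin n) K}
    (hh : HasMaximalPart d k h) (hg : ∀ i, (g i).IsHomogeneous d)
    (hgk : idealPart g k = homogeneousSubmodule (Fin n) K k) :
    idealPart h k = homogeneousSubmodule (Fin n) K k := by
  have : Module.Finite K (homogeneousSubmodule (Fin n) K k) :=
    Module.Finite.iff_fg.2 (homogeneousSubmodule_fg (Fin n) K k)
  exact Submodule.eq_of_le_of_finrank_le inf_le_right (hgk ▸ hh.2 g hg)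

theorem isHomogeneous_powerSystem (d : ℕ) (i : Fin n) :
    (powerSystem K n d i).IsHomogeneous d :=
  isHomogeneous_X_pow i d

theorem isHomogeneous_powerSumSystem (d : ℕ) (i : Fin (n + 1)) :
    (powerSumSystem K n d i).IsHomogeneous d := by
  induction i using Fin.lastCases with
  | last =>
    simpa [powerSumSystem] using
      (IsHomogeneous.sum Finset.univ _ 1 fun i _ => isHomogeneous_X K i).pow d
  | cast i => simpa [powerSumSystem] using isHomogeneous_powerSystem d i

theorem span_powerSumSystem (d : ℕ) :
    Ideal.span (Set.range (powerSumSystem K n d)) =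
      Ideal.span {(∑ i, X i) ^ d} ⊔ powerIdeal (Fin n) K d := by
  rw [powerSumSystem, Fin.range_snoc, Ideal.span_insert]
  rfl

theorem idealPart_powerSystem_eq {e k : ℕ} (hk : n * e < k) :
    idealPart (powerSystem K n (e + 1)) k = homogeneousSubmodule (Fin n) K k :=
  idealPart_eq_of_forall_mem fun _ hp => mem_powerIdeal_of_isHomogeneous e hp (by simpa using hk)

theorem idealPart_powerSumSystem_eq [CharZero K] {e i : ℕ} (hi : n * e ≤ 2 * i + (e + 1)) :
    idealPart (powerSumSystem K n (e + 1)) (i + (e + 1)) =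
      homogeneousSubmodule (Fin n) K (i + (e + 1)) := by
  refine idealPart_eq_of_forall_mem fun p hp => ?_
  obtain ⟨z, -, hz⟩ := exists_sum_X_pow_mul_sub_mem e hp (by simpa using hi)
  rw [span_powerSumSystem, ← sub_sub_cancel ((∑ i, X i) ^ (e + 1) * z) p]
  exact sub_mem (Ideal.mem_sup_left (Ideal.mul_mem_right _ _ (Ideal.mem_span_singleton_self _)))
    (Ideal.mem_sup_right hz)

theorem powerIdeal_zero (σ R : Type*) [Nonempty σ] [CommRing R] : powerIdeal σ R 0 = ⊤ := by
  rw [Ideal.eq_top_iff_one]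
  exact Ideal.subset_span ⟨Classical.arbitrary σ, pow_zero _⟩

theorem SquareCase.idealPart_powerSystem_eq {d : ℕ} (hnd : SquareCase n d) :
    idealPart (powerSystem K n d) (2 * d + 1) = homogeneousSubmodule (Fin n) K (2 * d + 1) := by
  unfold SquareCase at hnd
  cases d with
  | zero =>
    -- For `d = 0` every listed case has `n > 0`, so the system contains `1`.
    have : NeZero n := ⟨by omega⟩
    refine idealPart_eq_of_forall_mem fun p _ => ?_
    change p ∈ powerIdeal (Fin n) K 0
    simp [powerIdeal_zero]
  | succ e =>
    refine _root_.idealPart_powerSystem_eq ?_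
    rcases hnd with rfl | ⟨rfl, _⟩ | ⟨rfl, _⟩ | ⟨_, h⟩
    · omega
    · omega
    · omega
    · obtain rfl : e = 0 := by omega
      simp

theorem OverdeterminedCase.idealPart_powerSumSystem_eq [CharZero K] {d : ℕ}
    (hnd : OverdeterminedCase n d) :
    idealPart (powerSumSystem K n d) (2 * d + 1) = homogeneousSubmodule (Fin n) K (2 * d + 1) := by
  unfold OverdeterminedCase at hnd
  cases d with
  | zero =>
    have : NeZero n := ⟨by omega⟩
    refine idealPart_eq_of_forall_mem fun p _ => ?_
    simp [span_powerSumSystem, powerIdeal_zero]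
  | succ e =>
    -- The Lefschetz bound becomes `n * e ≤ 3 * e + 5`, which the listed cases satisfy.
    rw [show 2 * (e + 1) + 1 = (e + 2) + (e + 1) by ring]
    refine _root_.idealPart_powerSumSystem_eq ?_
    rcases hnd with rfl | rfl | ⟨rfl, _⟩ | ⟨rfl, _⟩ | ⟨rfl | rfl | rfl, _⟩ | ⟨_, h⟩
    iterate 7 omega
    obtain rfl : e = 0 := by omega
    simp

end IdealPart

theorem mainTheorem1 (K : Type*) [Field K] [CharZero K] (n d : ℕ) :
    (SquareCase n d →
      (∀ h : Fin n → MvPolynomial (Fin n) K, HasMaximalPart d (2 * d + 1) h →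
        idealPart h (2 * d + 1) = MvPolynomial.homogeneousSubmodule (Fin n) K (2 * d + 1)) ∧
      idealPart (powerSystem K n d) (2 * d + 1) =
        MvPolynomial.homogeneousSubmodule (Fin n) K (2 * d + 1)) ∧
    (OverdeterminedCase n d →
      (∀ h : Fin (n + 1) → MvPolynomial (Fin n) K, HasMaximalPart d (2 * d + 1) h →
        idealPart h (2 * d + 1) = MvPolynomial.homogeneousSubmodule (Fin n) K (2 * d + 1)) ∧
      idealPart (powerSumSystem K n d) (2 * d + 1) =
        MvPolynomial.homogeneousSubmodule (Fin n) K (2 * d + 1)) := by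
  refine ⟨fun hnd => ?_, fun hnd => ?_⟩
  · exact ⟨fun h hh => hh.idealPart_eq (isHomogeneous_powerSystem d) hnd.idealPart_powerSystem_eq,
      hnd.idealPart_powerSystem_eq⟩
  · exact ⟨fun h hh => hh.idealPart_eq (isHomogeneous_powerSumSystem d)
      hnd.idealPart_powerSumSystem_eq, hnd.idealPart_powerSumSystem_eq⟩
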